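/- Let $n,m\ge 0$ be integers and let $X=(X_t)_{t\ge 0}$ and $Y=(Y_t)_{t\ge 0}$ be independent Lévy processes on a probability space $(\Omega,\mathcal F,P)$ with values in $\mathbf R^n$ and $\mathbf R^m$, respectively, and put $Z_t=(X_t,Y_t)$. Assume that $X$, $Y$ and $Z$ have resolvent densities with respect to the Lebesgue measures on $\mathbf R^n$, $\mathbf R^m$ and $\mathbf R^{n+m}$, respectively. (A Lévy process $W$ in $\mathbf R^d$ has resolvent densities if for every $\alpha>0$ and every $x\in\mathbf R^d$ the measure $U^\alpha(x,B)=\int_0^\infty e^{-\alpha t}P(x+W_t\in B)\,dt$ has a density with respect to Lebesgue measure.) For a Lévy process $W$ in $\mathbf R^d$ with Lévy--Khintchine exponent $\psi$, that is $E[e^{i\langle z,W_t\rangle}]=e^{-t\psi(z)}$ for all $z\in\mathbf R^d$ and $t\ge 0$, for $\lambda>0$ and for a finite measure $\mu$ on $\mathbf R^d$, the $\lambda$-energy of $\mu$ for $W$ is $$E_W^\lambda(\mu)=\int_{\mathbf R^d}\mathrm{Re}\bigl([\lambda+\psi(z)]^{-1}\bigr)\,|\hat\mu(z)|^2\,dz\in[0,\infty],\qquad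 \hat\mu(z)=\int_{\mathbf R^d} e^{i\langle z,x\rangle}\,\mu(dx).$$ Let $\lambda>0$ and let $\nu$ be a finite measure with compact support on $\mathbf R^n\times\mathbf R^m$ such that $E_Z^\lambda(\nu)<\infty$. Then (i) the $\mathbf R^n$-marginal $\nu_1=\nu(\,\cdot\times\mathbf R^m)$ of $\nu$ satisfies $E_X^\lambda(\nu_1)<\infty$; (ii) the $\mathbf R^m$-marginal $\nu_2=\nu(\mathbf R^n\times\cdot\,)$ of $\nu$ satisfies $E_Y^\lambda(\nu_2)<\infty$. -/

import Mathlib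

open MeasureTheory ProbabilityTheory Filter Topology Set
open scoped NNReal ENNReal RealInnerProductSpace

namespace LevyEnergy

section Definitions

variable {Ω : Type*} [MeasurableSpace Ω] {E : Type*} [NormedAddCommGroup E]
  [InnerProductSpace ℝ E] [MeasurableSpace E] [BorelSpace E]

/-- `X` is a Lévy process on `(Ω, P)`: it starts at `0`, has independent and stationary increments,
and its paths are almost surely right-continuous with left limits. -/
structure IsLevyProcess (X : ℝ≥0 → Ω → E) (P : Measure Ω) : Prop where
  measurable : ∀ t, Measurable (X t)
  start_zero : ∀ᵐ ω ∂P, X 0 ω = 0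
  indep_increments : HasIndepIncrements X P
  stationary_increments : ∀ s t : ℝ≥0,
    IdentDistrib (fun ω => X (s + t) ω - X s ω) (X t) P P
  cadlag : ∀ᵐ ω ∂P, ∀ t : ℝ≥0,
    ContinuousWithinAt (fun s => X s ω) (Ici t) t ∧
      ∃ l : E, Tendsto (fun s => X s ω) (𝓝[<] t) (𝓝 l)

/-- `ψ` is the Lévy-Khintchine exponent of `X`: `𝔼[exp (i ⟨z, X_t⟩)] = exp (-t ψ(z))` for all
`z` and all `t ≥ 0`. -/
def IsLevyExponent (X : ℝ≥0 → Ω → E) (P : Measure Ω) (ψ : E → ℂ) : Prop :=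
  ∀ (z : E) (t : ℝ≥0), charFun (P.map (X t)) z = Complex.exp (-(t : ℂ) * ψ z)

open Classical in
/-- The Lévy-Khintchine exponent of the process `X`. For a Lévy process it exists and is unique, see
`IsLevyProcess.isLevyExponent_levyExponent` and `IsLevyExponent.unique`. -/
noncomputable def levyExponent (X : ℝ≥0 → Ω → E) (P : Measure Ω) : E → ℂ :=
  if h : ∃ ψ, IsLevyExponent X P ψ then h.choose else 0

/-- The resolvent operator `U^α f(x) = ∫₀^∞ e^{-αt} 𝔼[f(x + X_t)] dt`, for `f ≥ 0`. -/
noncomputable def resolvent (X : ℝ≥0 → Ω → E) (P : Measure Ω) (α : ℝ) (f : E → ℝ≥0∞) (x : E) :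
    ℝ≥0∞ :=
  ∫⁻ t in Ioi (0 : ℝ), ENNReal.ofReal (Real.exp (-α * t)) * ∫⁻ ω, f (x + X t.toNNReal ω) ∂P

/-- The process `X` has resolvent densities with respect to `m`: for all `α > 0` and all `x`, the
measure `U^α(x, ·)` has a density `u^α(x, ·)` with respect to `m`. -/
def HasResolventDensities (X : ℝ≥0 → Ω → E) (P : Measure Ω) (m : Measure E) : Prop :=
  ∀ α : ℝ, 0 < α → ∃ u : E → E → ℝ≥0∞, (∀ x, Measurable (u x)) ∧
    ∀ (x : E) (f : E → ℝ≥0∞), Measurable f → resolvent X P α f x = ∫⁻ y, u x y * f y ∂m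

/-- The `l`-energy `∫ Re([l + ψ(z)]⁻¹) |ν̂(z)|² dz` of the measure `ν` for the process `X` with
Lévy-Khintchine exponent `ψ`. The integrand is nonnegative for a Lévy process and `l > 0`. -/
noncomputable def energy [FiniteDimensional ℝ E] (X : ℝ≥0 → Ω → E) (P : Measure Ω) (l : ℝ)
    (ν : Measure E) : ℝ≥0∞ :=
  ∫⁻ z : E, ENNReal.ofReal (((l : ℂ) + levyExponent X P z)⁻¹.re * ‖charFun ν z‖ ^ 2)

/-- The process `Z_t = (X_t, Y_t)`, where the product space carries its Euclidean structure. -/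
def pairProcess {F : Type*} (X : ℝ≥0 → Ω → E) (Y : ℝ≥0 → Ω → F) : ℝ≥0 → Ω → WithLp 2 (E × F) :=
  fun t ω => WithLp.toLp 2 (X t ω, Y t ω)

end Definitions

section ExponentExists

theorem exists_exp_of_mul (f : ℝ≥0 → ℂ) (hf : Continuous f) (h0 : f 0 = 1)
    (hmul : ∀ s t, f (s + t) = f s * f t) :
    ∃ c : ℂ, ∀ t : ℝ≥0, f t = Complex.exp (-(t : ℂ) * c) := by
  set g : ℝ → ℂ := fun s => f s.toNNReal with hg
  have hgc : Continuous g := hf.comp continuous_real_toNNReal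
  have hg0 : g 0 = 1 := by simp [hg, h0]
  have hgm : ∀ s t : ℝ, 0 ≤ s → 0 ≤ t → g (s + t) = g s * g t := by
    intro s t hs ht
    simp only [hg]
    rw [Real.toNNReal_add hs ht, hmul]
  set F : ℝ → ℂ := fun x => ∫ s in (0 : ℝ)..x, g s with hF
  have hFd : ∀ x, HasDerivAt F (g x) x := fun x => hgc.integral_hasStrictDerivAt 0 x |>.hasDerivAt
  obtain ⟨a, ha, hFa⟩ : ∃ a : ℝ, 0 < a ∧ F a ≠ 0 := by
    by_contra! hcon
    have h1 : HasDerivWithinAt F 1 (Ici 0) 0 := by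
      simpa [hg0] using (hFd 0).hasDerivWithinAt
    have h2 : HasDerivWithinAt F 0 (Ici 0) 0 := by
      refine (hasDerivWithinAt_const (0 : ℝ) (Ici 0) (0 : ℂ)).congr ?_ (by simp [hF])
      intro x hx
      rcases eq_or_lt_of_le (show (0 : ℝ) ≤ x from hx) with h | h
      · simp [hF, ← h]
      · exact hcon x h
    exact one_ne_zero ((uniqueDiffWithinAt_Ici (0 : ℝ)).eq_deriv _ h1 h2)
  have hrep : ∀ t : ℝ, 0 ≤ t → g t * F a = F (t + a) - F t := by
    intro t ht
    have e1 : F (t + a) - F t = ∫ s in t..(t + a), g s :=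
      intervalIntegral.integral_interval_sub_left (hgc.intervalIntegrable _ _)
        (hgc.intervalIntegrable _ _)
    have e2 : (∫ s in t..(t + a), g s) = ∫ s in (0 : ℝ)..a, g (t + s) := by
      rw [intervalIntegral.integral_comp_add_left (fun s => g s) t]
      simp
    rw [e1, e2, hF]
    simp only
    rw [← intervalIntegral.integral_const_mul]
    refine intervalIntegral.integral_congr fun s hs => ?_
    rw [uIcc_of_le ha.le] at hs
    exact (hgm t s ht hs.1).symm
  set c : ℂ := (1 - g a) / F a with hc
  refine ⟨c, fun t => ?_⟩
  set k : ℝ → ℂ := fun s => (F (s + a) - F s) / F a * Complex.exp ((s : ℂ) * c) with hk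
  have hkd : ∀ s : ℝ, 0 ≤ s → HasDerivAt k 0 s := by
    intro s hs
    have d1 : HasDerivAt (fun s : ℝ => F (s + a) - F s) (g (s + a) - g s) s :=
      ((hFd (s + a)).comp_add_const s a).sub (hFd s)
    have d2 : HasDerivAt (fun s : ℝ => Complex.exp ((s : ℂ) * c))
        (Complex.exp ((s : ℂ) * c) * (1 * c)) s :=
      ((Complex.ofRealCLM.hasDerivAt (x := s)).mul_const c).cexp
    have d3 := (d1.div_const (F a)).mul d2
    have e : (0 : ℂ) = (g (s + a) - g s) / F a * Complex.exp ((s : ℂ) * c) +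
        (F (s + a) - F s) / F a * (Complex.exp ((s : ℂ) * c) * (1 * c)) := by
      rw [← hrep s hs, hgm s a hs ha.le, hc]
      field_simp
      ring
    rw [e]
    exact d3
  have hconst : k t = k 0 := by
    refine constant_of_has_deriv_right_zero (a := 0) (b := (t : ℝ)) (f := k) ?_ ?_ t
      ⟨t.2, le_rfl⟩
    · exact fun x hx => (hkd x hx.1).continuousAt.continuousWithinAt
    · exact fun x hx => (hkd x hx.1).hasDerivWithinAt
  have hk0 : k 0 = 1 := by
    simp only [hk]
    rw [← hrep 0 le_rfl, hg0]
    simp [hFa]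
  have hgt : g t = f t := by simp [hg]
  have hkt : k t = f t * Complex.exp ((t : ℂ) * c) := by
    simp only [hk]
    rw [← hrep t t.2, hgt, mul_div_assoc, div_self hFa, mul_one]
  rw [hkt, hk0] at hconst
  rw [neg_mul, Complex.exp_neg]
  exact eq_inv_of_mul_eq_one_left hconst

variable {Ω : Type*} [MeasurableSpace Ω] {P : Measure Ω} [IsProbabilityMeasure P]
  {E : Type*} [NormedAddCommGroup E] [InnerProductSpace ℝ E] [FiniteDimensional ℝ E]
  [MeasurableSpace E] [BorelSpace E] {X : ℝ≥0 → Ω → E}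

/-- Every Lévy process has a Lévy-Khintchine exponent. -/
theorem IsLevyProcess.exists_isLevyExponent (hX : IsLevyProcess X P) :
    ∃ ψ : E → ℂ, IsLevyExponent X P ψ := by
  have key : ∀ z : E, ∃ c : ℂ, ∀ t : ℝ≥0,
      charFun (P.map (X t)) z = Complex.exp (-(t : ℂ) * c) := by
    intro z
    have hprob : ∀ t, IsProbabilityMeasure (P.map (X t)) := fun t =>
      Measure.isProbabilityMeasure_map (hX.measurable t).aemeasurable
    have hform : ∀ t, charFun (P.map (X t)) z =
        ∫ ω, Complex.exp (((inner ℝ (X t ω) z : ℝ) : ℂ) * Complex.I) ∂P := by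
      intro t
      rw [charFun_apply, integral_map (hX.measurable t).aemeasurable]
      exact (by fun_prop : Continuous fun x : E =>
        Complex.exp (((inner ℝ x z : ℝ) : ℂ) * Complex.I)).aestronglyMeasurable
    have h0 : charFun (P.map (X 0)) z = 1 := by
      rw [hform]
      have : (fun ω => Complex.exp (((inner ℝ (X 0 ω) z : ℝ) : ℂ) * Complex.I)) =ᵐ[P]
          fun _ => (1 : ℂ) := by
        filter_upwards [hX.start_zero] with ω hω
        simp [hω]
      rw [integral_congr_ae this]
      simp
    have hmul : ∀ s t, charFun (P.map (X (s + t))) z =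
        charFun (P.map (X s)) z * charFun (P.map (X t)) z := by
      intro s t
      have hind : IndepFun (X s) (X (s + t) - X s) P :=
        hX.indep_increments.indepFun_eval_sub (zero_le (a := s)) le_self_add hX.start_zero
      have e := hind.charFun_map_add_eq_mul (hX.measurable s).aemeasurable
        ((hX.measurable (s + t)).sub (hX.measurable s)).aemeasurable
      have e2 : P.map (X (s + t) - X s) = P.map (X t) := (hX.stationary_increments s t).map_eq
      rw [e2, add_sub_cancel] at e
      rw [e]
      rfl
    have hlim : Tendsto (fun t => charFun (P.map (X t)) z) (𝓝 0) (𝓝 1) := by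
      rw [← h0]
      simp_rw [hform]
      refine tendsto_integral_filter_of_dominated_convergence (fun _ => (1 : ℝ)) ?_ ?_ ?_ ?_
      · refine Eventually.of_forall fun t => ?_
        have := hX.measurable t
        exact ((by fun_prop : Continuous fun x : E =>
          Complex.exp (((inner ℝ x z : ℝ) : ℂ) * Complex.I)).measurable.comp
            this).aestronglyMeasurable
      · refine Eventually.of_forall fun t => Eventually.of_forall fun ω => ?_
        rw [Complex.norm_exp_ofReal_mul_I]
      · exact integrable_const _
      · filter_upwards [hX.cadlag] with ω hω
        have h1 := (hω 0).1
        have h2 : Ici (0 : ℝ≥0) = univ := by ext; simp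
        rw [h2, continuousWithinAt_univ] at h1
        exact ((by fun_prop : Continuous fun x : E =>
          Complex.exp (((inner ℝ x z : ℝ) : ℂ) * Complex.I)).continuousAt.comp h1)
    have hle : ∀ s r, ‖charFun (P.map (X (s + r))) z - charFun (P.map (X s)) z‖ ≤
        ‖charFun (P.map (X r)) z - 1‖ := by
      intro s r
      rw [hmul]
      have : charFun (P.map (X s)) z * charFun (P.map (X r)) z - charFun (P.map (X s)) z =
          charFun (P.map (X s)) z * (charFun (P.map (X r)) z - 1) := by ring
      rw [this, norm_mul]
      have h1 := @norm_charFun_le_one E _ (P.map (X s)) _ _ (hprob s) z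
      exact mul_le_of_le_one_left (norm_nonneg _) h1
    have hcont : Continuous fun t => charFun (P.map (X t)) z := by
      rw [continuous_iff_continuousAt]
      intro t
      rw [ContinuousAt, tendsto_iff_norm_sub_tendsto_zero]
      have hd : Tendsto (fun s => nndist s t) (𝓝 t) (𝓝 0) := by
        have : Continuous fun s : ℝ≥0 => nndist s t := by fun_prop
        simpa using this.tendsto t
      have hb := tendsto_iff_norm_sub_tendsto_zero.1 (hlim.comp hd)
      refine squeeze_zero (fun _ => norm_nonneg _) (fun s => ?_) hb
      rcases le_total s t with h | h
      · have e : s + nndist s t = t := by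
          rw [NNReal.nndist_eq, tsub_eq_zero_of_le h]
          simp [h]
        have := hle s (nndist s t)
        rw [e, norm_sub_rev] at this
        exact this
      · have e : t + nndist s t = s := by
          rw [NNReal.nndist_eq, tsub_eq_zero_of_le h]
          simp [h]
        have := hle t (nndist s t)
        rw [e] at this
        exact this
    exact exists_exp_of_mul _ hcont h0 hmul
  choose ψ hψ using key
  exact ⟨ψ, hψ⟩

/-- The exponent of a Lévy process, as chosen above, has the defining property. -/
theorem IsLevyProcess.isLevyExponent_levyExponent (hX : IsLevyProcess X P) :
    IsLevyExponent X P (levyExponent X P) := by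
  have h := hX.exists_isLevyExponent
  rw [levyExponent, dif_pos h]
  exact h.choose_spec

end ExponentExists

/-- The Lévy-Khintchine exponent is unique. -/
theorem IsLevyExponent.unique {Ω : Type*} [MeasurableSpace Ω] {P : Measure Ω} {E : Type*}
    [NormedAddCommGroup E] [InnerProductSpace ℝ E] [MeasurableSpace E] [BorelSpace E]
    {X : ℝ≥0 → Ω → E} {ψ φ : E → ℂ} (hψ : IsLevyExponent X P ψ) (hφ : IsLevyExponent X P φ) :
    ψ = φ := by
  funext z
  have hd : ∀ c : ℂ, HasDerivWithinAt (fun t : ℝ => Complex.exp (-(t : ℂ) * c)) (-c) (Ici 0) 0 := by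
    intro c
    have h := (((Complex.ofRealCLM.hasDerivAt (x := (0 : ℝ))).neg.mul_const c).cexp).hasDerivWithinAt
      (s := Ici (0 : ℝ))
    simpa using h
  have h1 : HasDerivWithinAt (fun t : ℝ => Complex.exp (-(t : ℂ) * ψ z)) (-φ z) (Ici 0) 0 := by
    refine (hd (φ z)).congr (fun t ht => ?_) (by simp)
    have e := (hψ z ⟨t, ht⟩).symm.trans (hφ z ⟨t, ht⟩)
    exact e
  exact neg_injective ((uniqueDiffWithinAt_Ici (0 : ℝ)).eq_deriv _ (hd (ψ z)) h1)

end LevyEnergy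

/-!
Write `ψ` and `φ` for the exponents of `X` and `Y`; by independence `Z` has the exponent
`ψ z + φ w`. It suffices to bound the energy of the first marginal, the other one following by
exchanging the factors.

The Fourier transform of the first marginal at `z` is `ν̂ (z, 0)`, so the energy of `ν` has to
control an integral over the slice `w = 0`. Pointwise in `z`, the value `|ν̂ (z, 0)|²` is not
controlled by the values of `|ν̂ (z, w)|²` for `w` in a small ball `B`; positivity of the measures
on the space side is what allows a comparison after integration in `z`. Let `γ` be a Gaussian
weight on the `z`-frequencies and `β` Lebesgue measure on `B`. By Parseval
(`integral_charFun_mul_sq_norm_charFun`), the integral of `𝔼[exp (i ⟨z, X_t⟩)] |ν̂ (z, w)|²` with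
respect to `γ ⊗ β` is the integral of `γ̂ (k + x - x') β̂ (y - y')` with respect to
`law (X_t) ⊗ ν ⊗ ν`. Here `γ̂ ≥ 0`, and since `ν` has compact support the differences `y - y'`
stay in a bounded set, on which the real part of `β̂` is at least half the volume of `B` when `B`
is small (`half_volume_ball_le_re_charFun`). Replacing `β` by the Dirac mass at `0`, whose Fourier
transform is `1`, therefore increases the real part of the integral at most by a constant factor
(`re_integral_charFun_mul_le`). Integration against `e^{-lt}` in `t` turns
`𝔼[exp (i ⟨z, X_t⟩)] = e^{-t ψ(z)}` into `(l + ψ z)⁻¹` (`integral_re_inv_mul_le`).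

Finally, `φ` is continuous with `φ 0 = 0`, so `|φ| ≤ l` on a small `B`, and there
`Re (l + ψ z)⁻¹ ≤ 4 Re (l + ψ z + φ w)⁻¹` (`re_inv_le_four_mul_re_inv_add`). So the energy of the
marginal, weighted by the Gaussian, is bounded by a multiple of the energy of `ν` that does not
depend on the Gaussian, and Fatou's lemma removes the weight (`lintegral_fst_lt_top`).
-/

namespace LevyEnergy

/-! ### The Lévy-Khintchine exponent -/

section Exponent

variable {Ω : Type*} [MeasurableSpace Ω] {P : Measure Ω} [IsProbabilityMeasure P]
  {E : Type*} [NormedAddCommGroup E] [InnerProductSpace ℝ E] [FiniteDimensional ℝ E]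
  [MeasurableSpace E] [BorelSpace E] {X : ℝ≥0 → Ω → E} {ψ : E → ℂ}

omit [FiniteDimensional ℝ E] [BorelSpace E] in
theorem IsLevyExponent.re_nonneg (hψ : IsLevyExponent X P ψ) (hX : ∀ t, Measurable (X t))
    (z : E) : 0 ≤ (ψ z).re := by
  have := Measure.isProbabilityMeasure_map (μ := P) (hX 1).aemeasurable
  have h := norm_charFun_le_one (μ := P.map (X 1)) (t := z)
  rw [hψ z 1, Complex.norm_exp, Real.exp_le_one_iff] at h
  simpa using h

omit [FiniteDimensional ℝ E] in
theorem IsLevyExponent.apply_zero (hψ : IsLevyExponent X P ψ) (hX : ∀ t, Measurable (X t)) :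
    ψ 0 = 0 := by
  classical
  -- Changing the value at `0` to `0` gives an exponent again, so uniqueness applies.
  have h1 : IsLevyExponent X P (Function.update ψ 0 0) := by
    intro z t
    rcases eq_or_ne z 0 with rfl | hz
    · have := Measure.isProbabilityMeasure_map (μ := P) (hX t).aemeasurable
      simp
    · rw [Function.update_of_ne hz]
      exact hψ z t
  simpa using congrFun (hψ.unique h1) 0

theorem integral_exp_neg_mul_Ioi_zero {a : ℂ} (ha : 0 < a.re) :
    ∫ t in Ioi (0 : ℝ), Complex.exp (-(t : ℂ) * a) = a⁻¹ := by
  have h := integral_exp_mul_complex_Ioi (a := -a) (by simpa) 0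
  have e : ∀ t : ℝ, -(t : ℂ) * a = -a * t := fun t => by ring
  simp_rw [e, h]
  simp

/-- The exponent is recovered from `(1 + ψ)⁻¹ = ∫₀^∞ e^{-t} 𝔼[exp (i ⟨z, X_t⟩)] dt`, which is
continuous by dominated convergence; no logarithm has to be chosen. -/
theorem IsLevyExponent.continuous (hψ : IsLevyExponent X P ψ) (hX : ∀ t, Measurable (X t)) :
    Continuous ψ := by
  have hre : ∀ z, 0 < (1 + ψ z).re := fun z => by
    have := hψ.re_nonneg hX z
    simp only [Complex.add_re, Complex.one_re]
    linarith
  have h1 : Continuous fun z => ∫ t in Ioi (0 : ℝ), Complex.exp (-(t : ℂ) * (1 + ψ z)) := by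
    refine continuous_of_dominated (bound := fun t => Real.exp (-1 * t)) ?_ ?_ ?_ ?_
    · exact fun z => (by fun_prop : Continuous fun t : ℝ =>
        Complex.exp (-(t : ℂ) * (1 + ψ z))).aestronglyMeasurable
    · intro z
      filter_upwards [ae_restrict_mem measurableSet_Ioi] with t ht
      rw [Complex.norm_exp, Real.exp_le_exp]
      have := mul_nonneg (le_of_lt ht) (hψ.re_nonneg hX z)
      simp only [neg_mul, Complex.neg_re, Complex.re_ofReal_mul, Complex.add_re, Complex.one_re]
      nlinarith
    · exact exp_neg_integrableOn_Ioi 0 one_pos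
    · filter_upwards [ae_restrict_mem measurableSet_Ioi] with t ht
      have e : (fun z => Complex.exp (-(t : ℂ) * (1 + ψ z))) =
          fun z => Complex.exp (-(t : ℂ)) * charFun (P.map (X t.toNNReal)) z := by
        funext z
        rw [hψ z, ← Complex.exp_add]
        have : ((t.toNNReal : ℝ≥0) : ℂ) = (t : ℂ) := by
          have h0 := Real.coe_toNNReal t (le_of_lt ht)
          exact congrArg Complex.ofReal h0
        rw [this]
        ring_nf
      have := Measure.isProbabilityMeasure_map (μ := P) (hX t.toNNReal).aemeasurable
      rw [e]
      exact continuous_const.mul continuous_charFun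
  simp_rw [integral_exp_neg_mul_Ioi_zero (hre _)] at h1
  have hne : ∀ z, 1 + ψ z ≠ 0 := fun z h => by simpa [h] using hre z
  have h2 : Continuous fun z => ((1 + ψ z)⁻¹)⁻¹ - 1 :=
    (h1.inv₀ fun z => inv_ne_zero (hne z)).sub continuous_const
  simpa using h2

end Exponent

/-! ### Parseval's identity and the comparison at a fixed time -/

section Fourier

variable {E F : Type*} [NormedAddCommGroup E] [InnerProductSpace ℝ E] [FiniteDimensional ℝ E]
  [MeasurableSpace E] [BorelSpace E] [NormedAddCommGroup F] [InnerProductSpace ℝ F]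
  [FiniteDimensional ℝ F] [MeasurableSpace F] [BorelSpace F]

omit [FiniteDimensional ℝ E] in
theorem charFun_map_toLp (ν : Measure (E × F)) (z : E) (w : F) :
    charFun (ν.map (WithLp.toLp 2)) (WithLp.toLp 2 (z, w)) =
      ∫ p, Complex.exp (((inner ℝ p.1 z : ℝ) : ℂ) * Complex.I) *
        Complex.exp (((inner ℝ p.2 w : ℝ) : ℂ) * Complex.I) ∂ν := by
  rw [charFun_apply, integral_map (by fun_prop)
    (by fun_prop : Continuous fun x : WithLp 2 (E × F) =>
      Complex.exp (((inner ℝ x (WithLp.toLp 2 (z, w)) : ℝ) : ℂ) * Complex.I)).aestronglyMeasurable]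
  refine integral_congr_ae (Eventually.of_forall fun p => ?_)
  simp only [WithLp.prod_inner_apply, Complex.ofReal_add, add_mul, Complex.exp_add]

omit [FiniteDimensional ℝ E] in
theorem charFun_map_toLp_zero_right (ν : Measure (E × F)) (z : E) :
    charFun (ν.map (WithLp.toLp 2)) (WithLp.toLp 2 (z, (0 : F))) = charFun ν.fst z := by
  rw [charFun_map_toLp, charFun_apply, Measure.fst, integral_map (by fun_prop)
    (by fun_prop : Continuous fun x : E =>
      Complex.exp (((inner ℝ x z : ℝ) : ℂ) * Complex.I)).aestronglyMeasurable]
  simp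

theorem charFun_map_toLp_swap (ν : Measure (E × F)) (z : E) (w : F) :
    charFun ((ν.map Prod.swap).map (WithLp.toLp 2)) (WithLp.toLp 2 (w, z)) =
      charFun (ν.map (WithLp.toLp 2)) (WithLp.toLp 2 (z, w)) := by
  rw [charFun_map_toLp, charFun_map_toLp, integral_map (by fun_prop)
    (by fun_prop : Continuous fun p : F × E =>
      Complex.exp (((inner ℝ p.1 w : ℝ) : ℂ) * Complex.I) *
        Complex.exp (((inner ℝ p.2 z : ℝ) : ℂ) * Complex.I)).aestronglyMeasurable]
  simp [mul_comm]

theorem sq_norm_charFun_map_toLp (ν : Measure (E × F)) [IsFiniteMeasure ν] (z : E) (w : F) :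
    ((‖charFun (ν.map (WithLp.toLp 2)) (WithLp.toLp 2 (z, w))‖ ^ 2 : ℝ) : ℂ) =
      ∫ q : (E × F) × (E × F), Complex.exp (((inner ℝ (q.1.1 - q.2.1) z : ℝ) : ℂ) * Complex.I) *
        Complex.exp (((inner ℝ (q.1.2 - q.2.2) w : ℝ) : ℂ) * Complex.I) ∂(ν.prod ν) := by
  rw [Complex.ofReal_pow, ← Complex.mul_conj', charFun_map_toLp, ← integral_conj,
    ← integral_prod_mul]
  refine integral_congr_ae (Eventually.of_forall fun q => ?_)
  simp only [map_mul, ← Complex.exp_conj, Complex.conj_ofReal, Complex.conj_I, inner_sub_left,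
    Complex.ofReal_sub]
  simp only [← Complex.exp_add]
  ring_nf

/-- Parseval's identity for the finite measures `γ` and `β` on the frequency side and `μ`, `ν`,
`ν` on the space side. -/
theorem integral_charFun_mul_sq_norm_charFun (γ : Measure E) (β : Measure F) (μ : Measure E)
    (ν : Measure (E × F)) [IsFiniteMeasure γ] [IsFiniteMeasure β] [IsFiniteMeasure μ]
    [IsFiniteMeasure ν] :
    ∫ v : E × F, charFun μ v.1 *
        ((‖charFun (ν.map (WithLp.toLp 2)) (WithLp.toLp 2 v)‖ ^ 2 : ℝ) : ℂ) ∂(γ.prod β) =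
      ∫ s : E × ((E × F) × (E × F)), charFun γ (s.1 + (s.2.1.1 - s.2.2.1)) *
        charFun β (s.2.1.2 - s.2.2.2) ∂(μ.prod (ν.prod ν)) := by
  set f : (E × F) → (E × ((E × F) × (E × F))) → ℂ := fun v s =>
    Complex.exp (((inner ℝ v.1 (s.1 + (s.2.1.1 - s.2.2.1)) : ℝ) : ℂ) * Complex.I) *
      Complex.exp (((inner ℝ v.2 (s.2.1.2 - s.2.2.2) : ℝ) : ℂ) * Complex.I) with hf
  have e1 : ∀ v : E × F, charFun μ v.1 *
      ((‖charFun (ν.map (WithLp.toLp 2)) (WithLp.toLp 2 v)‖ ^ 2 : ℝ) : ℂ) =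
      ∫ s, f v s ∂(μ.prod (ν.prod ν)) := by
    rintro ⟨z, w⟩
    rw [sq_norm_charFun_map_toLp, charFun_apply, ← integral_prod_mul]
    refine integral_congr_ae (Eventually.of_forall fun s => ?_)
    simp only [hf, inner_add_right, Complex.ofReal_add, add_mul, Complex.exp_add,
      real_inner_comm _ z, real_inner_comm _ w]
    ring
  have e2 : ∀ s : E × ((E × F) × (E × F)), charFun γ (s.1 + (s.2.1.1 - s.2.2.1)) *
        charFun β (s.2.1.2 - s.2.2.2) = ∫ v, f v s ∂(γ.prod β) := by
    intro s
    rw [charFun_apply, charFun_apply, ← integral_prod_mul]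
  simp_rw [e1, e2]
  refine integral_integral_swap ?_
  refine Integrable.of_bound (C := 1) ?_ (Eventually.of_forall fun x => ?_)
  · exact (by simp only [hf, Function.uncurry_def]; fun_prop :
      Continuous (Function.uncurry f)).aestronglyMeasurable
  · simp only [hf, Function.uncurry_def, norm_mul, Complex.norm_exp_ofReal_mul_I, mul_one, le_refl]

/-- The comparison at a fixed time: where `μ` is the law of `X_t`, freezing the second frequency at
`0` costs only a constant, because the Fourier transform of `β` has real part at least `c` on the
differences of the second coordinates of points in the support of `ν`. -/
theorem re_integral_charFun_mul_le (γ : Measure E) (β : Measure F) (μ : Measure E)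
    (ν : Measure (E × F)) [IsFiniteMeasure γ] [IsFiniteMeasure β] [IsFiniteMeasure μ]
    [IsFiniteMeasure ν] (g : E → ℝ) (hg : ∀ x, charFun γ x = g x) (hg0 : ∀ x, 0 ≤ g x) {c : ℝ}
    (hc : ∀ᵐ q ∂(ν.prod ν), c ≤ (charFun β (q.1.2 - q.2.2)).re) :
    c * (∫ v : E × F, charFun μ v.1 * ((‖charFun (ν.map (WithLp.toLp 2))
        (WithLp.toLp 2 v)‖ ^ 2 : ℝ) : ℂ) ∂(γ.prod (Measure.dirac 0))).re ≤
      (∫ v : E × F, charFun μ v.1 * ((‖charFun (ν.map (WithLp.toLp 2))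
        (WithLp.toLp 2 v)‖ ^ 2 : ℝ) : ℂ) ∂(γ.prod β)).re := by
  rw [integral_charFun_mul_sq_norm_charFun, integral_charFun_mul_sq_norm_charFun]
  have hint : ∀ (β : Measure F) [IsFiniteMeasure β],
      Integrable (fun s : E × ((E × F) × (E × F)) => charFun γ (s.1 + (s.2.1.1 - s.2.2.1)) *
        charFun β (s.2.1.2 - s.2.2.2)) (μ.prod (ν.prod ν)) := by
    intro β _
    have h1 : Continuous (charFun γ) := continuous_charFun
    have h2 : Continuous (charFun β) := continuous_charFun
    refine Integrable.of_bound (C := γ.real univ * β.real univ)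
      (by fun_prop : Continuous _).aestronglyMeasurable (Eventually.of_forall fun s => ?_)
    rw [norm_mul]
    exact mul_le_mul (norm_charFun_le _) (norm_charFun_le _) (norm_nonneg _) measureReal_nonneg
  have hre : ∀ (β : Measure F) [IsFiniteMeasure β],
      (∫ s : E × ((E × F) × (E × F)), charFun γ (s.1 + (s.2.1.1 - s.2.2.1)) *
        charFun β (s.2.1.2 - s.2.2.2) ∂(μ.prod (ν.prod ν))).re =
      ∫ s : E × ((E × F) × (E × F)), g (s.1 + (s.2.1.1 - s.2.2.1)) *
        (charFun β (s.2.1.2 - s.2.2.2)).re ∂(μ.prod (ν.prod ν)) := by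
    intro β _
    refine (integral_re (hint β)).symm.trans ?_
    simp_rw [hg]
    simp
  have hint' : ∀ (β : Measure F) [IsFiniteMeasure β],
      Integrable (fun s : E × ((E × F) × (E × F)) => g (s.1 + (s.2.1.1 - s.2.2.1)) *
        (charFun β (s.2.1.2 - s.2.2.2)).re) (μ.prod (ν.prod ν)) := by
    intro β _
    have h := (hint β).re
    simp_rw [hg] at h
    simpa using h
  rw [hre, hre, ← integral_const_mul]
  refine integral_mono_ae ((hint' _).const_mul c) (hint' β) ?_
  have hc' : ∀ᵐ s ∂(μ.prod (ν.prod ν)), c ≤ (charFun β (s.2.1.2 - s.2.2.2)).re :=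
    Measure.quasiMeasurePreserving_snd.ae hc
  filter_upwards [hc'] with s hs
  have e : (charFun (Measure.dirac (0 : F)) (s.2.1.2 - s.2.2.2)).re = 1 := by simp
  rw [e, mul_one, mul_comm]
  exact mul_le_mul_of_nonneg_left hs (hg0 _)

end Fourier

/-! ### Laplace transforms in time -/

section Laplace

variable {T : Type*} [MeasurableSpace T]

theorem integrable_prod_exp_neg_mul (ρ : Measure T) [IsFiniteMeasure ρ] {l : ℝ} (hl : 0 < l)
    {a h : T → ℂ} (ha : Measurable a) (ha0 : ∀ v, 0 ≤ (a v).re) (hh : Measurable h) {C : ℝ}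
    (hC : ∀ v, ‖h v‖ ≤ C) :
    Integrable (fun q : ℝ × T => Complex.exp (-(q.1 : ℂ) * (l + a q.2)) * h q.2)
      ((volume.restrict (Ioi 0)).prod ρ) := by
  have h1 : Integrable (fun q : ℝ × T => Real.exp (-l * q.1) * C)
      ((volume.restrict (Ioi 0)).prod ρ) :=
    (exp_neg_integrableOn_Ioi 0 hl).mul_prod (integrable_const C)
  refine h1.mono' (by fun_prop : Measurable _).aestronglyMeasurable ?_
  have h2 : ∀ᵐ q ∂((volume.restrict (Ioi (0 : ℝ))).prod ρ), q.1 ∈ Ioi (0 : ℝ) :=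
    Measure.quasiMeasurePreserving_fst.ae (ae_restrict_mem measurableSet_Ioi)
  filter_upwards [h2] with q hq
  rw [norm_mul]
  refine mul_le_mul ?_ (hC _) (norm_nonneg _) (Real.exp_pos _).le
  rw [Complex.norm_exp, Real.exp_le_exp]
  have := mul_nonneg (le_of_lt hq) (ha0 q.2)
  simp only [neg_mul, Complex.neg_re, Complex.re_ofReal_mul, Complex.add_re, Complex.ofReal_re]
  nlinarith

theorem integral_exp_neg_mul_integral (ρ : Measure T) [IsFiniteMeasure ρ] {l : ℝ} (hl : 0 < l)
    {a h : T → ℂ} (ha : Measurable a) (ha0 : ∀ v, 0 ≤ (a v).re) (hh : Measurable h) {C : ℝ}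
    (hC : ∀ v, ‖h v‖ ≤ C) :
    ∫ t in Ioi (0 : ℝ), ∫ v, Complex.exp (-(t : ℂ) * (l + a v)) * h v ∂ρ =
      ∫ v, (l + a v)⁻¹ * h v ∂ρ := by
  rw [integral_integral_swap (integrable_prod_exp_neg_mul ρ hl ha ha0 hh hC)]
  refine integral_congr_ae (Eventually.of_forall fun v => ?_)
  simp only
  rw [integral_mul_const, integral_exp_neg_mul_Ioi_zero]
  have := ha0 v
  simp only [Complex.add_re, Complex.ofReal_re]
  linarith

theorem re_inv_add_nonneg {l : ℝ} (hl : 0 < l) {b : ℂ} (hb : 0 ≤ b.re) :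
    0 ≤ ((l : ℂ) + b)⁻¹.re := by
  rw [Complex.inv_re, Complex.add_re, Complex.ofReal_re]
  have := Complex.normSq_nonneg ((l : ℂ) + b)
  positivity

theorem re_inv_le_four_mul_re_inv_add {l : ℝ} (hl : 0 < l) {a b : ℂ} (ha : 0 ≤ a.re)
    (hb : 0 ≤ b.re) (hbl : ‖b‖ ≤ l) :
    ((l : ℂ) + a)⁻¹.re ≤ 4 * ((l : ℂ) + (a + b))⁻¹.re := by
  have hre : l ≤ ((l : ℂ) + a).re := by simpa using ha
  have hre' : ((l : ℂ) + a).re ≤ ((l : ℂ) + (a + b)).re := by simpa using hb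
  have h0 : l ≤ ‖(l : ℂ) + a‖ := hre.trans (Complex.re_le_norm _)
  have h1 : l ≤ ‖(l : ℂ) + (a + b)‖ := (hre.trans hre').trans (Complex.re_le_norm _)
  have h2 : ‖(l : ℂ) + (a + b)‖ ≤ 2 * ‖(l : ℂ) + a‖ := by
    rw [← add_assoc]
    have := norm_add_le ((l : ℂ) + a) b
    linarith
  have h3 : ‖(l : ℂ) + (a + b)‖ ^ 2 ≤ 4 * ‖(l : ℂ) + a‖ ^ 2 := by nlinarith
  rw [Complex.inv_re, Complex.inv_re, Complex.normSq_eq_norm_sq, Complex.normSq_eq_norm_sq,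
    ← mul_div_assoc, div_le_div_iff₀ (pow_pos (hl.trans_le h0) 2) (pow_pos (hl.trans_le h1) 2)]
  calc _ ≤ ((l : ℂ) + (a + b)).re * (4 * ‖(l : ℂ) + a‖ ^ 2) :=
        mul_le_mul hre' h3 (by positivity) (by linarith)
    _ = _ := by ring

end Laplace

/-! ### Gaussian weights and balls on the frequency side -/

section Kernels

variable (E : Type*) [NormedAddCommGroup E] [InnerProductSpace ℝ E] [FiniteDimensional ℝ E]
  [MeasurableSpace E] [BorelSpace E]

/-- The measure with density `exp (-ε ‖z‖²)` with respect to Lebesgue measure, unnormalized so that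
it increases to Lebesgue measure as `ε` decreases to `0`. -/
noncomputable def gaussianWeight (ε : ℝ) : Measure E :=
  volume.withDensity fun z => ENNReal.ofReal (Real.exp (-ε * ‖z‖ ^ 2))

theorem integrable_exp_neg_mul_sq_norm {ε : ℝ} (hε : 0 < ε) :
    Integrable fun z : E => Real.exp (-ε * ‖z‖ ^ 2) := by
  have h := (GaussianFourier.integrable_cexp_neg_mul_sq_norm_add (V := E) (b := (ε : ℂ))
    (by simpa) 0 0).norm
  refine h.congr (Eventually.of_forall fun z => ?_)
  simp only [Complex.norm_exp]
  norm_cast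
  simp

theorem isFiniteMeasure_gaussianWeight {ε : ℝ} (hε : 0 < ε) :
    IsFiniteMeasure (gaussianWeight E ε) :=
  isFiniteMeasure_withDensity_ofReal (integrable_exp_neg_mul_sq_norm E hε).2

theorem gaussianWeight_le {ε : ℝ} (hε : 0 ≤ ε) : gaussianWeight E ε ≤ volume := by
  conv_rhs => rw [← withDensity_one (μ := (volume : Measure E))]
  refine withDensity_mono (Eventually.of_forall fun z => ?_)
  rw [Pi.one_apply, ENNReal.ofReal_le_one, Real.exp_le_one_iff]
  nlinarith [sq_nonneg ‖z‖]

variable {E}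

theorem charFun_gaussianWeight {ε : ℝ} (hε : 0 < ε) (x : E) :
    charFun (gaussianWeight E ε) x =
      (((Real.pi / ε) ^ (Module.finrank ℝ E / 2 : ℝ) * Real.exp (-‖x‖ ^ 2 / (4 * ε)) : ℝ) : ℂ) := by
  have h := GaussianFourier.integral_cexp_neg_mul_sq_norm_add (V := E) (b := (ε : ℂ))
    (by simpa) Complex.I x
  rw [charFun_apply, gaussianWeight, integral_withDensity_eq_integral_toReal_smul (by fun_prop)
    (by simp)]
  rw [Complex.ofReal_mul, Complex.ofReal_cpow (by positivity), Complex.ofReal_exp]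
  push_cast
  refine Eq.trans ?_ (h.trans ?_)
  · refine integral_congr_ae (Eventually.of_forall fun z => ?_)
    simp only
    rw [ENNReal.toReal_ofReal (Real.exp_pos _).le, Complex.real_smul, Complex.ofReal_exp,
      ← Complex.exp_add, real_inner_comm]
    push_cast
    ring_nf
  · simp

theorem lintegral_le_of_forall_gaussianWeight {f : E → ℝ≥0∞} (hf : Measurable f) {C : ℝ≥0∞}
    (h : ∀ ε : ℝ, 0 < ε → ∫⁻ z, f z ∂(gaussianWeight E ε) ≤ C) : ∫⁻ z, f z ≤ C := by
  set k : ℕ → E → ℝ≥0∞ := fun n z =>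
    ENNReal.ofReal (Real.exp (-(1 / ((n : ℝ) + 1)) * ‖z‖ ^ 2)) * f z with hk
  have hlim : ∀ z, Tendsto (fun n => k n z) atTop (𝓝 (f z)) := by
    intro z
    have h1 : Tendsto (fun n : ℕ => Real.exp (-(1 / ((n : ℝ) + 1)) * ‖z‖ ^ 2)) atTop (𝓝 1) := by
      have h2 := ((tendsto_one_div_add_atTop_nhds_zero_nat (𝕜 := ℝ)).neg.mul_const (‖z‖ ^ 2)).rexp
      simpa using h2
    have h3 := ENNReal.Tendsto.mul_const (b := f z) (ENNReal.tendsto_ofReal h1) (by simp)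
    simpa only [one_mul, ENNReal.ofReal_one] using h3
  calc ∫⁻ z, f z = ∫⁻ z, liminf (fun n => k n z) atTop :=
        lintegral_congr fun z => (hlim z).liminf_eq.symm
    _ ≤ liminf (fun n => ∫⁻ z, k n z) atTop := lintegral_liminf_le fun n => by fun_prop
    _ ≤ C := by
      refine liminf_le_of_le (by isBoundedDefault) fun b hb => ?_
      obtain ⟨n, hn⟩ := hb.exists
      refine hn.trans (le_trans (le_of_eq ?_) (h (1 / ((n : ℝ) + 1)) (by positivity)))
      rw [gaussianWeight, lintegral_withDensity_eq_lintegral_mul _ (by fun_prop) hf]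
      rfl

/-- On vectors `y` with `δ ‖y‖ ≤ 1` the phases `⟪w, y⟫`, `‖w‖ < δ`, stay in `[-1, 1]`, where
`cos ≥ 1 / 2`. -/
theorem half_volume_ball_le_re_charFun {δ : ℝ} {y : E} (hy : δ * ‖y‖ ≤ 1) :
    volume.real (Metric.ball (0 : E) δ) / 2 ≤
      (charFun (volume.restrict (Metric.ball (0 : E) δ)) y).re := by
  have hfin : IsFiniteMeasure (volume.restrict (Metric.ball (0 : E) δ)) :=
    isFiniteMeasure_restrict.2 measure_ball_lt_top.ne
  have hint : Integrable (fun w : E => Complex.exp (((inner ℝ w y : ℝ) : ℂ) * Complex.I))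
      (volume.restrict (Metric.ball (0 : E) δ)) :=
    Integrable.of_bound (C := 1) (by fun_prop : Continuous _).aestronglyMeasurable
      (Eventually.of_forall fun w => by rw [Complex.norm_exp_ofReal_mul_I])
  have e : (charFun (volume.restrict (Metric.ball (0 : E) δ)) y).re =
      ∫ w in Metric.ball (0 : E) δ, Real.cos (inner ℝ w y) := by
    rw [charFun_apply]
    refine (integral_re hint).symm.trans ?_
    simp [Complex.exp_ofReal_mul_I_re]
  have e2 : volume.real (Metric.ball (0 : E) δ) / 2 =
      ∫ _ in Metric.ball (0 : E) δ, (1 / 2 : ℝ) := by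
    simp [div_eq_mul_inv]
  rw [e, e2]
  refine integral_mono_ae (integrable_const _) ?_ ?_
  · exact Integrable.of_bound (C := 1) (by fun_prop : Continuous _).aestronglyMeasurable
      (Eventually.of_forall fun w => Real.abs_cos_le_one _)
  · filter_upwards [ae_restrict_mem Metric.isOpen_ball.measurableSet] with w hw
    have h1 : |inner ℝ w y| ≤ 1 := (abs_real_inner_le_norm w y).trans
      ((mul_le_mul_of_nonneg_right (by simpa using (mem_ball_zero_iff.1 hw).le)
        (norm_nonneg y)).trans hy)
    have h2 := Real.one_sub_sq_div_two_le_cos (x := inner ℝ w y)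
    have h3 : (inner ℝ w y) ^ 2 ≤ 1 := (sq_le_one_iff_abs_le_one _).2 h1
    linarith

end Kernels

/-! ### Energies of marginals -/

section Comparison

variable {Ω : Type*} [MeasurableSpace Ω] {P : Measure Ω} [IsProbabilityMeasure P]
  {E F : Type*} [NormedAddCommGroup E] [InnerProductSpace ℝ E] [FiniteDimensional ℝ E]
  [MeasurableSpace E] [BorelSpace E] [NormedAddCommGroup F] [InnerProductSpace ℝ F]
  [FiniteDimensional ℝ F] [MeasurableSpace F] [BorelSpace F] {X : ℝ≥0 → Ω → E} {ψ : E → ℂ}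

theorem measurable_charFun_map_toLp (ν : Measure (E × F)) [IsFiniteMeasure ν] :
    Measurable fun v : E × F => charFun (ν.map (WithLp.toLp 2)) (WithLp.toLp 2 v) :=
  (continuous_charFun (μ := ν.map (WithLp.toLp 2))).measurable.comp
    (by fun_prop : Continuous fun v : E × F => WithLp.toLp 2 v).measurable

omit [FiniteDimensional ℝ E] [BorelSpace E] [FiniteDimensional ℝ F] [BorelSpace F] in
theorem norm_charFun_map_toLp_sq_le (ν : Measure (E × F)) [IsFiniteMeasure ν] (v : E × F) :
    ‖charFun (ν.map (WithLp.toLp 2)) (WithLp.toLp 2 v)‖ ^ 2 ≤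
      (ν.map (WithLp.toLp 2)).real univ ^ 2 :=
  pow_le_pow_left₀ (norm_nonneg _) (norm_charFun_le _) 2

theorem integrable_inv_mul_sq_norm_charFun (ρ : Measure (E × F)) [IsFiniteMeasure ρ]
    (ν : Measure (E × F)) [IsFiniteMeasure ν] (hψ : Measurable ψ) (hψ0 : ∀ z, 0 ≤ (ψ z).re)
    {l : ℝ} (hl : 0 < l) :
    Integrable (fun v : E × F => ((l : ℂ) + ψ v.1)⁻¹ * ((‖charFun (ν.map (WithLp.toLp 2))
      (WithLp.toLp 2 v)‖ ^ 2 : ℝ) : ℂ)) ρ := by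
  have hm := measurable_charFun_map_toLp ν
  refine Integrable.of_bound (C := l⁻¹ * (ν.map (WithLp.toLp 2)).real univ ^ 2)
    (by fun_prop : Measurable _).aestronglyMeasurable (Eventually.of_forall fun v => ?_)
  rw [norm_mul, norm_inv, Complex.norm_real, Real.norm_of_nonneg (by positivity)]
  refine mul_le_mul ?_ (norm_charFun_map_toLp_sq_le ν v) (by positivity) (by positivity)
  refine inv_anti₀ hl (le_trans ?_ (Complex.re_le_norm _))
  simpa using hψ0 v.1

/-- Integrating the comparison at time `t` against `e^{-lt}` replaces the law of `X_t` by the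
resolvent, whose Fourier transform is `(l + ψ)⁻¹`. -/
theorem integral_re_inv_mul_le (hX : ∀ t, Measurable (X t)) (hψ : IsLevyExponent X P ψ)
    (γ : Measure E) (β : Measure F) (ν : Measure (E × F)) [IsFiniteMeasure γ] [IsFiniteMeasure β]
    [IsFiniteMeasure ν] (g : E → ℝ) (hg : ∀ x, charFun γ x = g x) (hg0 : ∀ x, 0 ≤ g x) {c : ℝ}
    (hc : ∀ᵐ q ∂(ν.prod ν), c ≤ (charFun β (q.1.2 - q.2.2)).re) {l : ℝ} (hl : 0 < l) :
    c * ∫ z, ((l : ℂ) + ψ z)⁻¹.re * ‖charFun ν.fst z‖ ^ 2 ∂γ ≤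
      ∫ v : E × F, ((l : ℂ) + ψ v.1)⁻¹.re *
        ‖charFun (ν.map (WithLp.toLp 2)) (WithLp.toLp 2 v)‖ ^ 2 ∂(γ.prod β) := by
  set h : E × F → ℂ := fun v =>
    ((‖charFun (ν.map (WithLp.toLp 2)) (WithLp.toLp 2 v)‖ ^ 2 : ℝ) : ℂ) with hh
  have hψm : Measurable ψ := (hψ.continuous hX).measurable
  have hψ0 := hψ.re_nonneg hX
  have hm := measurable_charFun_map_toLp ν
  have hhm : Measurable h := by fun_prop
  have hhC : ∀ v, ‖h v‖ ≤ (ν.map (WithLp.toLp 2)).real univ ^ 2 := fun v => by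
    rw [hh, Complex.norm_real, Real.norm_of_nonneg (by positivity)]
    exact norm_charFun_map_toLp_sq_le ν v
  have ham : Measurable fun v : E × F => ψ v.1 := hψm.comp measurable_fst
  have hint : ∀ (ρ : Measure (E × F)) [IsFiniteMeasure ρ], IntegrableOn (fun t : ℝ =>
      ∫ v, Complex.exp (-(t : ℂ) * (l + ψ v.1)) * h v ∂ρ) (Ioi 0) := fun ρ _ =>
    (integrable_prod_exp_neg_mul ρ hl ham (fun v => hψ0 v.1) hhm hhC).integral_prod_left
  have hre : ∀ (ρ : Measure (E × F)) [IsFiniteMeasure ρ],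
      ∫ v : E × F, ((l : ℂ) + ψ v.1)⁻¹.re *
        ‖charFun (ν.map (WithLp.toLp 2)) (WithLp.toLp 2 v)‖ ^ 2 ∂ρ =
      ∫ t in Ioi (0 : ℝ), (∫ v, Complex.exp (-(t : ℂ) * (l + ψ v.1)) * h v ∂ρ).re := by
    intro ρ _
    refine Eq.trans ?_ (integral_re (hint ρ)).symm
    rw [integral_exp_neg_mul_integral ρ hl ham (fun v => hψ0 v.1) hhm hhC]
    refine Eq.trans ?_ (integral_re (integrable_inv_mul_sq_norm_charFun ρ ν hψm hψ0 hl))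
    refine integral_congr_ae (Eventually.of_forall fun v => ?_)
    simp only [hh, RCLike.re_to_complex, Complex.re_mul_ofReal]
  -- The left-hand side is the integral for the Dirac mass at `0` in place of `β`.
  have e0 : ∫ z, ((l : ℂ) + ψ z)⁻¹.re * ‖charFun ν.fst z‖ ^ 2 ∂γ =
      ∫ v : E × F, ((l : ℂ) + ψ v.1)⁻¹.re *
        ‖charFun (ν.map (WithLp.toLp 2)) (WithLp.toLp 2 v)‖ ^ 2 ∂(γ.prod (Measure.dirac 0)) := by
    rw [Measure.prod_dirac, integral_map (by fun_prop)
      (by fun_prop : Measurable _).aestronglyMeasurable]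
    simp_rw [charFun_map_toLp_zero_right]
  rw [e0, hre, hre, ← integral_const_mul]
  refine setIntegral_mono_on ((hint _).re.const_mul c) (hint _).re measurableSet_Ioi
    fun t ht => ?_
  have := Measure.isProbabilityMeasure_map (μ := P) (hX t.toNNReal).aemeasurable
  have e : ∀ ρ : Measure (E × F), (∫ v, Complex.exp (-(t : ℂ) * (l + ψ v.1)) * h v ∂ρ).re =
      Real.exp (-t * l) *
        (∫ v : E × F, charFun (P.map (X t.toNNReal)) v.1 * h v ∂ρ).re := by
    intro ρ
    rw [← Complex.re_ofReal_mul, ← integral_const_mul]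
    congr 1
    refine integral_congr_ae (Eventually.of_forall fun v => ?_)
    simp only
    have ht' : ((t.toNNReal : ℝ≥0) : ℂ) = (t : ℂ) :=
      congrArg Complex.ofReal (Real.coe_toNNReal t (le_of_lt ht))
    rw [hψ v.1, ht', mul_add, Complex.exp_add, Complex.ofReal_exp]
    push_cast
    ring
  rw [e, e, mul_left_comm]
  exact mul_le_mul_of_nonneg_left (re_integral_charFun_mul_le γ β _ ν g hg hg0 hc)
    (Real.exp_pos _).le

/-- The marginal of `ν` has finite energy as soon as the energy of `ν` itself, with exponent
`ψ z + φ w`, is finite. -/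
theorem lintegral_fst_lt_top (hX : ∀ t, Measurable (X t)) (hψ : IsLevyExponent X P ψ)
    {φ : F → ℂ} (hφ : Continuous φ) (hφ0 : φ 0 = 0) (hφre : ∀ w, 0 ≤ (φ w).re)
    (ν : Measure (E × F)) [IsFiniteMeasure ν] {R : ℝ} (hR : ∀ᵐ p ∂ν, ‖p.2‖ ≤ R) {l : ℝ}
    (hl : 0 < l)
    (hν : ∫⁻ v : E × F, ENNReal.ofReal (((l : ℂ) + (ψ v.1 + φ v.2))⁻¹.re *
      ‖charFun (ν.map (WithLp.toLp 2)) (WithLp.toLp 2 v)‖ ^ 2) < ∞) :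
    ∫⁻ z, ENNReal.ofReal (((l : ℂ) + ψ z)⁻¹.re * ‖charFun ν.fst z‖ ^ 2) < ∞ := by
  have hψm : Measurable ψ := (hψ.continuous hX).measurable
  have hψ0 := hψ.re_nonneg hX
  have hφm := hφ.measurable
  have hm := measurable_charFun_map_toLp ν
  -- The radius `δ` makes `‖φ‖ < l` on the ball, and `δ ‖y - y'‖ ≤ 1` if `‖y‖, ‖y'‖ ≤ R`.
  obtain ⟨δ₀, hδ₀, hδφ⟩ := Metric.continuousAt_iff.1 hφ.continuousAt l hl
  set δ : ℝ := min δ₀ (1 / (2 * |R| + 1)) with hδ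
  have hδpos : 0 < δ := lt_min hδ₀ (by positivity)
  set β : Measure F := volume.restrict (Metric.ball (0 : F) δ) with hβ
  have hfin : IsFiniteMeasure β := isFiniteMeasure_restrict.2 measure_ball_lt_top.ne
  set c : ℝ := volume.real (Metric.ball (0 : F) δ) / 2 with hcdef
  have hcpos : 0 < c := half_pos
    (ENNReal.toReal_pos (Metric.measure_ball_pos volume _ hδpos).ne' measure_ball_lt_top.ne)
  have hc : ∀ᵐ q ∂(ν.prod ν), c ≤ (charFun β (q.1.2 - q.2.2)).re := by
    have h1 : ∀ᵐ q ∂(ν.prod ν), ‖q.1.2‖ ≤ R := Measure.quasiMeasurePreserving_fst.ae hR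
    have h2 : ∀ᵐ q ∂(ν.prod ν), ‖q.2.2‖ ≤ R := Measure.quasiMeasurePreserving_snd.ae hR
    filter_upwards [h1, h2] with q hq1 hq2
    refine half_volume_ball_le_re_charFun ?_
    have h3 : ‖q.1.2 - q.2.2‖ ≤ 2 * |R| + 1 := by
      have := norm_sub_le q.1.2 q.2.2
      have := le_abs_self R
      linarith
    calc δ * ‖q.1.2 - q.2.2‖ ≤ 1 / (2 * |R| + 1) * (2 * |R| + 1) :=
          mul_le_mul (min_le_right _ _) h3 (norm_nonneg _) (by positivity)
      _ = 1 := by field_simp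
  set B : ℝ≥0∞ := ∫⁻ v : E × F, ENNReal.ofReal (((l : ℂ) + (ψ v.1 + φ v.2))⁻¹.re *
      ‖charFun (ν.map (WithLp.toLp 2)) (WithLp.toLp 2 v)‖ ^ 2) with hB
  have hbound : ∀ γ : Measure E, γ ≤ volume → SFinite γ →
      ∫⁻ v : E × F, ENNReal.ofReal (((l : ℂ) + ψ v.1)⁻¹.re *
        ‖charFun (ν.map (WithLp.toLp 2)) (WithLp.toLp 2 v)‖ ^ 2) ∂(γ.prod β) ≤
      ENNReal.ofReal 4 * B := by
    intro γ hγ _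
    rw [hB, ← lintegral_const_mul _ (by fun_prop), Measure.volume_eq_prod,
      lintegral_prod _ (by fun_prop), lintegral_prod _ (by fun_prop)]
    refine lintegral_mono' hγ fun z => ?_
    refine (setLIntegral_mono' Metric.isOpen_ball.measurableSet fun w hw => ?_).trans
      (setLIntegral_le_lintegral _ _)
    rw [← ENNReal.ofReal_mul (by norm_num), ← mul_assoc]
    refine ENNReal.ofReal_le_ofReal (mul_le_mul_of_nonneg_right ?_ (by positivity))
    refine re_inv_le_four_mul_re_inv_add hl (hψ0 z) (hφre w) ?_
    have := hδφ (lt_of_lt_of_le (Metric.mem_ball.1 hw) (min_le_left _ _))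
    rw [hφ0, dist_zero_right] at this
    exact this.le
  have key : ∫⁻ z, ENNReal.ofReal (((l : ℂ) + ψ z)⁻¹.re * ‖charFun ν.fst z‖ ^ 2) ≤
      ENNReal.ofReal c⁻¹ * (ENNReal.ofReal 4 * B) := by
    have hm1 : Measurable (charFun ν.fst) := measurable_charFun
    refine lintegral_le_of_forall_gaussianWeight (by fun_prop) fun ε hε => ?_
    have := isFiniteMeasure_gaussianWeight E hε
    have h1 := integral_re_inv_mul_le hX hψ (gaussianWeight E ε) β ν _
      (charFun_gaussianWeight hε) (fun x => by positivity) hc hl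
    have hi := (integrable_inv_mul_sq_norm_charFun ((gaussianWeight E ε).prod β) ν hψm hψ0 hl).re
    simp only [RCLike.re_to_complex, Complex.re_mul_ofReal] at hi
    have hi0 := (integrable_inv_mul_sq_norm_charFun
      ((gaussianWeight E ε).prod (Measure.dirac (0 : F))) ν hψm hψ0 hl).re
    simp only [RCLike.re_to_complex, Complex.re_mul_ofReal, Measure.prod_dirac] at hi0
    rw [integrable_map_measure (by fun_prop : Measurable _).aestronglyMeasurable
      (by fun_prop)] at hi0
    simp only [Function.comp_def, charFun_map_toLp_zero_right] at hi0
    rw [← ofReal_integral_eq_lintegral_ofReal hi0 (Eventually.of_forall fun z =>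
      mul_nonneg (re_inv_add_nonneg hl (hψ0 z)) (by positivity))]
    refine le_trans ?_ (mul_le_mul_right (hbound _ (gaussianWeight_le E hε.le) inferInstance) _)
    rw [← ofReal_integral_eq_lintegral_ofReal hi (Eventually.of_forall fun v =>
      mul_nonneg (re_inv_add_nonneg hl (hψ0 v.1)) (by positivity)),
      ← ENNReal.ofReal_mul (by positivity)]
    refine ENNReal.ofReal_le_ofReal ?_
    rw [inv_mul_eq_div, le_div_iff₀ hcpos, mul_comm]
    exact h1
  exact key.trans_lt (ENNReal.mul_lt_top ENNReal.ofReal_lt_top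
    (ENNReal.mul_lt_top ENNReal.ofReal_lt_top hν))

omit [IsProbabilityMeasure P] in
theorem energy_eq_of_isLevyExponent (hψ : IsLevyExponent X P ψ) (l : ℝ) (ν : Measure E) :
    energy X P l ν = ∫⁻ z, ENNReal.ofReal (((l : ℂ) + ψ z)⁻¹.re * ‖charFun ν z‖ ^ 2) := by
  have h : ∃ ψ, IsLevyExponent X P ψ := ⟨ψ, hψ⟩
  have e : levyExponent X P = ψ := by
    rw [levyExponent, dif_pos h]
    exact h.choose_spec.unique hψ
  rw [energy, e]

theorem IsLevyExponent.pairProcess {Y : ℝ≥0 → Ω → F} {φ : F → ℂ} (hX : ∀ t, Measurable (X t))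
    (hY : ∀ t, Measurable (Y t)) (hind : ∀ t, IndepFun (X t) (Y t) P)
    (hψ : IsLevyExponent X P ψ) (hφ : IsLevyExponent Y P φ) :
    IsLevyExponent (pairProcess X Y) P fun v => ψ v.fst + φ v.snd := by
  intro z t
  have h := (indepFun_iff_charFun_prod (hX t).aemeasurable (hY t).aemeasurable).1 (hind t) z
  rw [mul_add, Complex.exp_add, ← hψ, ← hφ]
  exact h

end Comparison

end LevyEnergy

theorem mainTheorem5 {n m : ℕ} {Ω : Type*} [MeasurableSpace Ω] (P : Measure Ω)
    [IsProbabilityMeasure P]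
    (X : ℝ≥0 → Ω → EuclideanSpace ℝ (Fin n)) (Y : ℝ≥0 → Ω → EuclideanSpace ℝ (Fin m))
    (hX : LevyEnergy.IsLevyProcess X P) (hY : LevyEnergy.IsLevyProcess Y P)
    (hXY : IndepFun (fun ω t => X t ω) (fun ω t => Y t ω) P)
    (hXdens : LevyEnergy.HasResolventDensities X P volume)
    (hYdens : LevyEnergy.HasResolventDensities Y P volume)
    (hZdens : LevyEnergy.HasResolventDensities (LevyEnergy.pairProcess X Y) P volume)
    (l : ℝ) (hl : 0 < l)
    (ν : Measure (EuclideanSpace ℝ (Fin n) × EuclideanSpace ℝ (Fin m))) [IsFiniteMeasure ν]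
    (hνsupp : IsCompact ν.support)
    (hν : LevyEnergy.energy (LevyEnergy.pairProcess X Y) P l (ν.map (WithLp.toLp 2)) < ∞) :
    LevyEnergy.energy X P l ν.fst < ∞ ∧ LevyEnergy.energy Y P l ν.snd < ∞ := by
  obtain ⟨ψ, hψ⟩ := hX.exists_isLevyExponent
  obtain ⟨φ, hφ⟩ := hY.exists_isLevyExponent
  have hind : ∀ t, IndepFun (X t) (Y t) P := fun t =>
    hXY.comp (measurable_pi_apply t) (measurable_pi_apply t)
  obtain ⟨R, hR⟩ := hνsupp.isBounded.exists_norm_le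
  have hνR : ∀ᵐ p ∂ν, ‖p‖ ≤ R := by
    filter_upwards [ν.support_mem_ae] with p hp using hR p hp
  rw [LevyEnergy.energy_eq_of_isLevyExponent (hψ.pairProcess hX.measurable hY.measurable hind hφ),
    ← (WithLp.volume_preserving_toLp _ _).lintegral_comp_emb
      (MeasurableEquiv.toLp 2 _).measurableEmbedding] at hν
  rw [LevyEnergy.energy_eq_of_isLevyExponent hψ, LevyEnergy.energy_eq_of_isLevyExponent hφ]
  constructor
  · exact LevyEnergy.lintegral_fst_lt_top hX.measurable hψ (hφ.continuous hY.measurable)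
      (hφ.apply_zero hY.measurable) (hφ.re_nonneg hY.measurable) ν
      (hνR.mono fun p hp => (norm_snd_le p).trans hp) hl hν
  · have hs : (ν.map Prod.swap).fst = ν.snd := Measure.fst_map_swap
    rw [← hs]
    refine LevyEnergy.lintegral_fst_lt_top hY.measurable hφ (hψ.continuous hX.measurable)
      (hψ.apply_zero hX.measurable) (hψ.re_nonneg hX.measurable) (ν.map Prod.swap) (R := R) ?_ hl ?_
    · refine (ae_map_iff (by fun_prop) (by measurability)).2 ?_
      exact hνR.mono fun p hp => (norm_fst_le p).trans hp
    · refine lt_of_eq_of_lt ?_ hν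
      rw [Measure.volume_eq_prod, Measure.volume_eq_prod, ← lintegral_prod_swap]
      refine lintegral_congr fun v => ?_
      obtain ⟨z, w⟩ := v
      simp only [Prod.swap_prod_mk, LevyEnergy.charFun_map_toLp_swap, add_comm (φ w),
        WithLp.toLp_fst, WithLp.toLp_snd]
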